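/- Work in $\mathbb{C}^3\otimes\mathbb{C}^3\otimes\mathbb{C}^3$ (parties $A,B,C$) with computational basis $|p,q,r\rangle=|p\rangle_A\otimes|q\rangle_B\otimes|r\rangle_C$, $p,q,r\in\{0,1,2\}$. For $i,j\in\{0,1\}$ put $|\eta_i\rangle=|0\rangle+(-1)^i|1\rangle$, $|\xi_j\rangle=|1\rangle+(-1)^j|2\rangle$, and $$|\psi(i,j)\rangle_1=|0,\eta_i,\xi_j\rangle,\quad |\psi(i,j)\rangle_2=|\eta_i,2,\xi_j\rangle,\quad |\psi(i,j)\rangle_3=|2,\xi_j,\eta_i\rangle,$$ $$|\psi(i,j)\rangle_4=|\eta_i,\xi_j,0\rangle,\quad |\psi(i,j)\rangle_5=|\xi_j,0,\eta_i\rangle,\quad |\psi(i,j)\rangle_6=|\xi_j,\eta_i,2\rangle.$$ Let $|S\rangle=(|0\rangle+|1\rangle+|2\rangle)^{\otimes 3}$ and $$\mathcal{U}=\{|S\rangle\}\cup\{|\psi(i,j)\rangle_l : 1\le l\le 6,\ (i,j)\neq(0,0)\},\qquad \rho=\frac18\Big(\mathbb{I}_{27}-\sum_{|\psi\rangle\in\mathcal{U}}|\tilde\psi\rangle\langle\tilde\psi|\Big),$$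 where $|\tilde\psi\rangle=|\psi\rangle/\|\psi\|$. A density operator is a positive semidefinite operator of trace $1$. For each of the three bipartite cuts $A|BC$, $B|CA$, $C|AB$, written $X|YZ$, let $\mathcal{B}(X|YZ)$ be the convex hull of the pure states $|\chi\rangle\langle\chi|$ with $|\chi\rangle=|\alpha\rangle_X\otimes|\beta\rangle_{YZ}$ for unit vectors $|\alpha\rangle,|\beta\rangle$, and let $\mathcal{P}(X|YZ)$ be the set of density operators whose partial transposes with respect to $X$ and to $YZ$ are positive semidefinite. Let $\mathcal{B}^{int}(3\otimes3\otimes3)$ and $\mathcal{P}^{int}(3\otimes3\otimes3)$ be the intersections of the three sets $\mathcal{B}(X|YZ)$ and of the three sets $\mathcal{P}(X|YZ)$, respectively. Then the following hold. 1. $\mathcal{U}$ has $19$ elements and is an unextendible product basis: it consists of nonzero, mutually orthogonal, fully product vectors, it does not span the whole space, and no nonzero vector of the form $|a\rangle_A\otimes|b\rangle_B\otimes|c\rangle_C$ is orthogonal to all of its elements. 2. $\rho$ is a density operator of rank $8$, and $8\rho$ is the orthogonal projector onto the orthogonal complement of $\mathcal{U}$. 3. $\rho$ is invariant under each of the partial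 transpositions $T_A,T_B,T_C$ (in the computational basis), and $\rho\in\mathcal{P}^{int}(3\otimes3\otimes3)$, that is, $\rho$ is PPT across all three cuts. 4. $\rho$ is not separable across any of the three cuts: $\rho\notin\mathcal{B}(A|BC)$, $\rho\notin\mathcal{B}(B|CA)$ and $\rho\notin\mathcal{B}(C|AB)$; in particular $\rho\notin\mathcal{B}^{int}(3\otimes3\otimes3)$. -/

import Mathlib

open scoped Matrix ComplexOrder

namespace Tripartite

noncomputable section

/-! ## States of a tripartite system

The Hilbert space `ℂ^X ⊗ ℂ^Y ⊗ ℂ^Z` of three parties A, B, C is written in its computational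
basis: a vector is a function `X × Y × Z → ℂ` of its coefficients, an operator is a matrix
indexed by `X × Y × Z`. -/

section General

variable {X Y Z : Type} [Fintype X] [Fintype Y] [Fintype Z]

/-- The operator `|ψ⟩⟨ψ|`. -/
def proj {I : Type} (ψ : I → ℂ) : Matrix I I ℂ :=
  Matrix.vecMulVec ψ (star ψ)

/-- The Hermitian inner product `⟨ψ|φ⟩`, conjugate linear in `ψ`. -/
def braket {I : Type} [Fintype I] (ψ φ : I → ℂ) : ℂ :=
  star ψ ⬝ᵥ φ

/-- The Hilbert space norm `√⟨ψ|ψ⟩`. -/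
def ketNorm {I : Type} [Fintype I] (ψ : I → ℂ) : ℝ :=
  ‖(WithLp.toLp 2 ψ : EuclideanSpace ℂ I)‖

/-- The normalized vector proportional to a nonzero `ψ`. -/
def normalized {I : Type} [Fintype I] (ψ : I → ℂ) : I → ℂ :=
  ((ketNorm ψ : ℂ)⁻¹) • ψ

/-- The fully product vector `|a⟩_A ⊗ |b⟩_B ⊗ |c⟩_C = |a, b, c⟩`. -/
def prodKet (a : X → ℂ) (b : Y → ℂ) (c : Z → ℂ) : X × Y × Z → ℂ :=
  fun x => a x.1 * b x.2.1 * c x.2.2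

/-- The set `𝒟` of density operators. -/
def densityOps (I : Type) [Fintype I] : Set (Matrix I I ℂ) :=
  {ρ | ρ.PosSemidef ∧ ρ.trace = 1}

/-! ### Partial transposes -/

/-- Partial transposition with respect to A, in the computational basis. -/
def ptA (ρ : Matrix (X × Y × Z) (X × Y × Z) ℂ) : Matrix (X × Y × Z) (X × Y × Z) ℂ :=
  Matrix.of fun p q => ρ (q.1, p.2.1, p.2.2) (p.1, q.2.1, q.2.2)

/-- Partial transposition with respect to B, in the computational basis. -/
def ptB (ρ : Matrix (X × Y × Z) (X × Y × Z) ℂ) : Matrix (X × Y × Z) (X × Y × Z) ℂ :=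
  Matrix.of fun p q => ρ (p.1, q.2.1, p.2.2) (q.1, p.2.1, q.2.2)

/-- Partial transposition with respect to C, in the computational basis. -/
def ptC (ρ : Matrix (X × Y × Z) (X × Y × Z) ℂ) : Matrix (X × Y × Z) (X × Y × Z) ℂ :=
  Matrix.of fun p q => ρ (p.1, p.2.1, q.2.2) (q.1, q.2.1, p.2.2)

variable (X Y Z)

/-! ### PPT states -/

/-- `𝒫(A|BC)`: density operators whose partial transposes with respect to A and to BC are
both positive semidefinite. -/
def pptA : Set (Matrix (X × Y × Z) (X × Y × Z) ℂ) :=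
  {ρ | ρ ∈ densityOps (X × Y × Z) ∧ (ptA ρ).PosSemidef ∧ (ptB (ptC ρ)).PosSemidef}

/-- `𝒫(B|CA)`. -/
def pptB : Set (Matrix (X × Y × Z) (X × Y × Z) ℂ) :=
  {ρ | ρ ∈ densityOps (X × Y × Z) ∧ (ptB ρ).PosSemidef ∧ (ptC (ptA ρ)).PosSemidef}

/-- `𝒫(C|AB)`. -/
def pptC : Set (Matrix (X × Y × Z) (X × Y × Z) ℂ) :=
  {ρ | ρ ∈ densityOps (X × Y × Z) ∧ (ptC ρ).PosSemidef ∧ (ptA (ptB ρ)).PosSemidef}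

/-- `𝒫^int(ABC)`. -/
def pptInt : Set (Matrix (X × Y × Z) (X × Y × Z) ℂ) :=
  pptA X Y Z ∩ pptB X Y Z ∩ pptC X Y Z

/-! ### States separable across a cut -/

/-- `ℬ(A|BC)`: the convex hull of the pure states `|ψ⟩_A ⊗ |φ⟩_BC`. -/
def bisepA : Set (Matrix (X × Y × Z) (X × Y × Z) ℂ) :=
  convexHull ℝ {σ | ∃ (ψ : X → ℂ) (φ : Y × Z → ℂ), ketNorm ψ = 1 ∧ ketNorm φ = 1 ∧
    σ = proj fun x : X × Y × Z => ψ x.1 * φ (x.2.1, x.2.2)}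

/-- `ℬ(B|CA)`: the convex hull of the pure states `|ψ⟩_B ⊗ |φ⟩_CA`. -/
def bisepB : Set (Matrix (X × Y × Z) (X × Y × Z) ℂ) :=
  convexHull ℝ {σ | ∃ (ψ : Y → ℂ) (φ : Z × X → ℂ), ketNorm ψ = 1 ∧ ketNorm φ = 1 ∧
    σ = proj fun x : X × Y × Z => ψ x.2.1 * φ (x.2.2, x.1)}

/-- `ℬ(C|AB)`: the convex hull of the pure states `|ψ⟩_C ⊗ |φ⟩_AB`. -/
def bisepC : Set (Matrix (X × Y × Z) (X × Y × Z) ℂ) :=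
  convexHull ℝ {σ | ∃ (ψ : Z → ℂ) (φ : X × Y → ℂ), ketNorm ψ = 1 ∧ ketNorm φ = 1 ∧
    σ = proj fun x : X × Y × Z => ψ x.2.2 * φ (x.1, x.2.1)}

/-- `ℬ^int(ABC)`. -/
def bisepInt : Set (Matrix (X × Y × Z) (X × Y × Z) ℂ) :=
  bisepA X Y Z ∩ bisepB X Y Z ∩ bisepC X Y Z

variable {X Y Z}

/-- An unextendible product basis: a set of nonzero, mutually orthogonal, fully product vectors
which does not span the whole space, and such that no nonzero fully product vector is
orthogonal to all of them. -/
structure IsUPB (U : Finset (X × Y × Z → ℂ)) : Prop where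
  product : ∀ ψ ∈ U, ∃ (a : X → ℂ) (b : Y → ℂ) (c : Z → ℂ), ψ = prodKet a b c
  ne_zero : ∀ ψ ∈ U, ψ ≠ 0
  orthogonal : ∀ ψ ∈ U, ∀ φ ∈ U, ψ ≠ φ → braket ψ φ = 0
  incomplete : ∃ v : X × Y × Z → ℂ, v ≠ 0 ∧ ∀ ψ ∈ U, braket ψ v = 0
  unextendible : ∀ (a : X → ℂ) (b : Y → ℂ) (c : Z → ℂ),
    (∀ ψ ∈ U, braket ψ (prodKet a b c) = 0) → prodKet a b c = 0

end General

/-! ## The construction in `(ℂ³)^{⊗3}` -/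

/-- The basis vector `|k⟩` of `ℂ³`. -/
def ket (k : Fin 3) : Fin 3 → ℂ := Pi.single k 1

/-- `|η_i⟩ = |0⟩ + (-1)^i |1⟩`. -/
def eta (i : Fin 2) : Fin 3 → ℂ := ket 0 + (-1 : ℂ) ^ (i : ℕ) • ket 1

/-- `|ξ_j⟩ = |1⟩ + (-1)^j |2⟩`. -/
def xi (j : Fin 2) : Fin 3 → ℂ := ket 1 + (-1 : ℂ) ^ (j : ℕ) • ket 2

/-- `|ψ(i,j)⟩_l` for `l = 1, …, 6`; the Lean index of `l` is `l - 1`. -/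
def psi (l : Fin 6) (i j : Fin 2) : Fin 3 × Fin 3 × Fin 3 → ℂ :=
  ![prodKet (ket 0) (eta i) (xi j),
    prodKet (eta i) (ket 2) (xi j),
    prodKet (ket 2) (xi j) (eta i),
    prodKet (eta i) (xi j) (ket 0),
    prodKet (xi j) (ket 0) (eta i),
    prodKet (xi j) (eta i) (ket 2)] l

/-- `|S⟩ = (|0⟩ + |1⟩ + |2⟩)^{⊗3}`. -/
def stopper : Fin 3 × Fin 3 × Fin 3 → ℂ :=
  prodKet (ket 0 + ket 1 + ket 2) (ket 0 + ket 1 + ket 2) (ket 0 + ket 1 + ket 2)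

open Classical in
/-- The set consisting of `|S⟩` and all `|ψ(i,j)⟩_l` with `(i,j) ≠ (0,0)`. -/
def upb3 : Finset (Fin 3 × Fin 3 × Fin 3 → ℂ) :=
  insert stopper
    (((Finset.univ : Finset (Fin 6 × Fin 2 × Fin 2)).filter fun t => t.2 ≠ (0, 0)).image
      fun t => psi t.1 t.2.1 t.2.2)

/-- `ρ^{[3]}(8) = (1/8) (𝕀₂₇ - ∑ |ψ̃⟩⟨ψ̃|)`, the sum over the set above, where `ψ̃` is `ψ`
normalized. -/
def rho3 : Matrix (Fin 3 × Fin 3 × Fin 3) (Fin 3 × Fin 3 × Fin 3) ℂ :=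
  (1 / 8 : ℂ) • (1 - ∑ ψ ∈ upb3, proj (normalized ψ))

end

end Tripartite

open Tripartite

namespace Tripartite

/-! ## Projections onto the orthogonal complement of an orthogonal set -/

section General

variable {I : Type} [Fintype I]

/-! The 27 basis cells split into six tiles of four cells (the supports of the six families) and the
three diagonal cells. The three vectors kept on a tile are the nonconstant sign patterns, so a
vector is orthogonal to the basis exactly when it is constant on tiles and its coefficients sum to
zero; only the forward direction is needed (`tileConstant_of_orthogonal`).

Such a vector that is also a product across `A|BC` vanishes at `|111⟩` (`TileConstant.mid_eq_zero`).
A cyclic shift of the parties permutes the tiles, so this holds for every cut. In a separable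
decomposition of `ρ`, each pure state of positive weight is orthogonal to the basis, hence vanishes
at `|111⟩`; but the entry of `ρ` there is nonzero. This excludes all three cuts.

For a fully product vector the same lemma makes some middle factor zero, and the tiles then kill the
rest (`TileConstant.prodKet_eq_zero`), which is unextendibility. Partial transpositions fix `ρ`
because the basis consists of real product vectors; positivity of the partial transposes follows.
The rank is the trace `27 - 19` of a projection. -/

theorem braket_smul_right (c : ℂ) (ψ φ : I → ℂ) : braket ψ (c • φ) = c * braket ψ φ := by
  simp [braket]

theorem star_braket (ψ φ : I → ℂ) : star (braket ψ φ) = braket φ ψ := by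
  simp [braket, dotProduct, mul_comm]

theorem braket_self (ψ : I → ℂ) : braket ψ ψ = (ketNorm ψ : ℂ) ^ 2 := by
  rw [← Complex.ofReal_pow, ketNorm, EuclideanSpace.norm_sq_eq, braket, dotProduct]
  push_cast
  refine Finset.sum_congr rfl fun x _ => ?_
  rw [← Complex.conj_mul']
  rfl

theorem ketNorm_ne_zero {ψ : I → ℂ} (hψ : ψ ≠ 0) : ketNorm ψ ≠ 0 := by
  simpa [ketNorm] using hψ

theorem braket_self_ne_zero {ψ : I → ℂ} (hψ : ψ ≠ 0) : braket ψ ψ ≠ 0 := by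
  rw [braket_self]
  exact pow_ne_zero 2 (by exact_mod_cast ketNorm_ne_zero hψ)

theorem proj_smul (c : ℂ) (ψ : I → ℂ) : proj (c • ψ) = (c * star c) • proj ψ := by
  ext p q
  simp [proj, Matrix.vecMulVec_apply]
  ring

theorem proj_normalized (ψ : I → ℂ) : proj (normalized ψ) = (braket ψ ψ)⁻¹ • proj ψ := by
  rw [normalized, proj_smul, braket_self]
  congr 1
  simp [sq]

theorem proj_mulVec (ψ v : I → ℂ) : proj ψ *ᵥ v = braket ψ v • ψ := by
  rw [proj, Matrix.vecMulVec_mulVec, braket, op_smul_eq_smul]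

theorem proj_mul_proj_of_orthogonal {ψ φ : I → ℂ} (h : braket ψ φ = 0) :
    proj ψ * proj φ = 0 := by
  rw [proj, proj, Matrix.vecMulVec_mul_vecMulVec, show star ψ ⬝ᵥ φ = 0 from h]
  simp

theorem proj_mul_self (ψ : I → ℂ) : proj ψ * proj ψ = braket ψ ψ • proj ψ := by
  rw [proj, Matrix.vecMulVec_mul_vecMulVec, Matrix.vecMulVec_smul]
  rfl

theorem trace_proj (ψ : I → ℂ) : (proj ψ).trace = braket ψ ψ := by
  rw [proj, Matrix.trace_vecMulVec, dotProduct_comm]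
  rfl

theorem proj_isSelfAdjoint {I : Type} (ψ : I → ℂ) : IsSelfAdjoint (proj ψ) := by
  rw [isSelfAdjoint_iff, Matrix.star_eq_conjTranspose, proj, Matrix.conjTranspose_vecMulVec,
    star_star]

variable {U : Finset (I → ℂ)}

theorem isStarProjection_sum_proj_normalized (h0 : ∀ ψ ∈ U, ψ ≠ 0)
    (ho : ∀ ψ ∈ U, ∀ φ ∈ U, ψ ≠ φ → braket ψ φ = 0) :
    IsStarProjection (∑ ψ ∈ U, proj (normalized ψ)) where
  isIdempotentElem := by
    rw [IsIdempotentElem, Finset.sum_mul_sum]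
    refine Finset.sum_congr rfl fun ψ hψ => ?_
    rw [Finset.sum_eq_single_of_mem ψ hψ]
    · rw [proj_normalized, smul_mul_smul_comm, proj_mul_self, smul_smul, mul_assoc,
        inv_mul_cancel₀ (braket_self_ne_zero (h0 ψ hψ)), mul_one]
    · intro φ hφ hne
      rw [proj_normalized, proj_normalized, smul_mul_smul_comm,
        proj_mul_proj_of_orthogonal (ho ψ hψ φ hφ hne.symm), smul_zero]
  isSelfAdjoint := by
    rw [isSelfAdjoint_iff, star_sum]
    exact Finset.sum_congr rfl fun ψ _ => proj_isSelfAdjoint _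

theorem trace_sum_proj_normalized (h0 : ∀ ψ ∈ U, ψ ≠ 0) :
    (∑ ψ ∈ U, proj (normalized ψ)).trace = U.card := by
  rw [Matrix.trace_sum, Finset.sum_congr rfl fun ψ hψ => ?_, Finset.sum_const, nsmul_one]
  rw [proj_normalized, Matrix.trace_smul, trace_proj, smul_eq_mul,
    inv_mul_cancel₀ (braket_self_ne_zero (h0 ψ hψ))]

theorem sum_proj_normalized_mulVec (v : I → ℂ) :
    (∑ ψ ∈ U, proj (normalized ψ)) *ᵥ v = ∑ ψ ∈ U, ((braket ψ ψ)⁻¹ * braket ψ v) • ψ := by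
  rw [Matrix.sum_mulVec]
  refine Finset.sum_congr rfl fun ψ _ => ?_
  rw [proj_normalized, Matrix.smul_mulVec, proj_mulVec, smul_smul]

theorem braket_sum_proj_normalized_mulVec (h0 : ∀ ψ ∈ U, ψ ≠ 0)
    (ho : ∀ ψ ∈ U, ∀ φ ∈ U, ψ ≠ φ → braket ψ φ = 0) {ψ : I → ℂ} (hψ : ψ ∈ U) (v : I → ℂ) :
    braket ψ ((∑ φ ∈ U, proj (normalized φ)) *ᵥ v) = braket ψ v := by
  rw [sum_proj_normalized_mulVec, braket, dotProduct_sum, Finset.sum_eq_single_of_mem ψ hψ]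
  · change braket ψ _ = _
    rw [braket_smul_right, mul_right_comm, inv_mul_cancel₀ (braket_self_ne_zero (h0 ψ hψ)),
      one_mul]
  · intro φ hφ hne
    change braket ψ _ = _
    rw [braket_smul_right, ho ψ hψ φ hφ hne.symm, mul_zero]

theorem sum_proj_normalized_mulVec_eq_zero_iff (h0 : ∀ ψ ∈ U, ψ ≠ 0)
    (ho : ∀ ψ ∈ U, ∀ φ ∈ U, ψ ≠ φ → braket ψ φ = 0) (v : I → ℂ) :
    (∑ ψ ∈ U, proj (normalized ψ)) *ᵥ v = 0 ↔ ∀ ψ ∈ U, braket ψ v = 0 := by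
  constructor
  · intro h ψ hψ
    rw [← braket_sum_proj_normalized_mulVec h0 ho hψ, h, braket, dotProduct_zero]
  · intro h
    rw [sum_proj_normalized_mulVec]
    exact Finset.sum_eq_zero fun ψ hψ => by rw [h ψ hψ, mul_zero, zero_smul]

theorem sum_proj_normalized_mulVec_self (h0 : ∀ ψ ∈ U, ψ ≠ 0)
    (ho : ∀ ψ ∈ U, ∀ φ ∈ U, ψ ≠ φ → braket ψ φ = 0) {ψ : I → ℂ} (hψ : ψ ∈ U) :
    (∑ φ ∈ U, proj (normalized φ)) *ᵥ ψ = ψ := by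
  rw [sum_proj_normalized_mulVec, Finset.sum_eq_single_of_mem ψ hψ]
  · rw [inv_mul_cancel₀ (braket_self_ne_zero (h0 ψ hψ)), one_smul]
  · intro φ hφ hne
    rw [ho φ hφ ψ hψ hne, mul_zero, zero_smul]

theorem posSemidef_of_isStarProjection {P : Matrix I I ℂ} (hP : IsStarProjection P) :
    P.PosSemidef := by
  have h : Pᴴ * P = P := by
    rw [← Matrix.star_eq_conjTranspose, hP.isSelfAdjoint.star_eq, hP.isIdempotentElem.eq]
  rw [← h]
  exact Matrix.posSemidef_conjTranspose_mul_self P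

theorem trace_eq_rank_of_isIdempotentElem [DecidableEq I] {P : Matrix I I ℂ} (hP : IsIdempotentElem P) :
    P.trace = P.rank := by
  have h : IsIdempotentElem (Matrix.toLin' P) := by
    rw [IsIdempotentElem, Module.End.mul_eq_comp, ← Matrix.toLin'_mul, hP.eq]
  have := (LinearMap.isProj_range_iff_isIdempotentElem _).2 h |>.trace
  rw [← Matrix.trace_toLin'_eq, this, Matrix.rank]
  rfl

/-- The range criterion, in the form needed here: if `ρ` is a mixture of pure states and
annihilates `U`, then a coefficient that vanishes for all the pure states orthogonal to `U`
vanishes for `ρ`. -/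
theorem diag_eq_zero_of_mem_convexHull {S : Set (Matrix I I ℂ)} {ρ : Matrix I I ℂ}
    (hρ : ρ ∈ convexHull ℝ S) (hker : ∀ ψ ∈ U, ρ *ᵥ ψ = 0) (k : I)
    (hS : ∀ σ ∈ S, ∃ χ : I → ℂ, σ = proj χ ∧ ((∀ ψ ∈ U, braket ψ χ = 0) → χ k = 0)) :
    ρ k k = 0 := by
  obtain ⟨ι, _, w, z, hw, -, hz, rfl⟩ := mem_convexHull_iff_exists_fintype.1 hρ
  choose χ hχ hk using fun i => hS (z i) (hz i)
  -- Expanding `⟨ψ|ρ|ψ⟩ = 0` gives a vanishing sum of nonnegative terms.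
  have key : ∀ ψ ∈ U, ∀ i, w i * Complex.normSq (braket ψ (χ i)) = 0 := by
    intro ψ hψ
    have h : ((∑ i, w i * Complex.normSq (braket ψ (χ i)) : ℝ) : ℂ) =
        braket ψ ((∑ i, w i • z i) *ᵥ ψ) := by
      rw [Matrix.sum_mulVec, braket, dotProduct_sum]
      push_cast
      refine Finset.sum_congr rfl fun i _ => ?_
      rw [hχ i, Matrix.smul_mulVec, proj_mulVec, dotProduct_smul, dotProduct_smul,
        ← star_braket ψ (χ i), Complex.normSq_eq_conj_mul_self, Complex.real_smul]
      rfl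
    rw [hker ψ hψ, braket, dotProduct_zero, Complex.ofReal_eq_zero,
      Finset.sum_eq_zero_iff_of_nonneg
        fun i _ => mul_nonneg (hw i) (Complex.normSq_nonneg _)] at h
    exact fun i => h i (Finset.mem_univ i)
  rw [Matrix.sum_apply]
  refine Finset.sum_eq_zero fun i _ => ?_
  rcases eq_or_ne (w i) 0 with h | h
  · simp [h]
  · have : χ i k = 0 := hk i fun ψ hψ => by simpa [h] using key ψ hψ i
    simp [hχ i, proj, Matrix.vecMulVec_apply, this]

end General

/-! ## The orthogonal product vectors -/

/-- The fully product vector with integer coefficients whose three factors are `f 0`, `f 1`,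
`f 2`. -/
noncomputable def intKet (f : Fin 3 → Fin 3 → ℤ) : Fin 3 × Fin 3 × Fin 3 → ℂ :=
  prodKet (fun k => (f 0 k : ℂ)) (fun k => (f 1 k : ℂ)) (fun k => (f 2 k : ℂ))

/-- Inner products of product vectors factor over the parties, which reduces orthogonality to a
decidable integer identity. -/
theorem braket_intKet (f g : Fin 3 → Fin 3 → ℤ) :
    braket (intKet f) (intKet g) = ((∏ p, ∑ k, f p k * g p k : ℤ) : ℂ) := by
  simp [braket, dotProduct, Fintype.sum_prod_type, Fin.sum_univ_three, Fin.prod_univ_three,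
    intKet, prodKet]
  ring

/-- The factors of `|S⟩` (at `none`) and of `|ψ(i,j)⟩_l` (at `some (l, i, j)`). -/
def factors : Option (Fin 6 × Fin 2 × Fin 2) → Fin 3 → Fin 3 → ℤ
  | none => fun _ _ => 1
  | some (l, i, j) =>
    let η : Fin 3 → ℤ := ![1, (-1) ^ (i : ℕ), 0]
    let ξ : Fin 3 → ℤ := ![0, 1, (-1) ^ (j : ℕ)]
    ![![![1, 0, 0], η, ξ], ![η, ![0, 0, 1], ξ], ![![0, 0, 1], ξ, η],
      ![η, ξ, ![1, 0, 0]], ![ξ, ![1, 0, 0], η], ![ξ, η, ![0, 0, 1]]] l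

/-- The labels of the elements of the basis. -/
def labels : Finset (Option (Fin 6 × Fin 2 × Fin 2)) :=
  Finset.insertNone (Finset.univ.filter fun t => t.2 ≠ (0, 0))

theorem card_labels : labels.card = 19 := by
  decide

theorem factors_orthogonal : ∀ s ∈ labels, ∀ t ∈ labels, s ≠ t →
    ∏ p, ∑ k, factors s p k * factors t p k = 0 := by
  decide +kernel

theorem factors_self_ne_zero : ∀ s ∈ labels, ∏ p, ∑ k, factors s p k * factors s p k ≠ 0 := by
  decide +kernel

theorem stopper_eq_intKet : stopper = intKet (factors none) := by
  have h : (ket 0 + ket 1 + ket 2 : Fin 3 → ℂ) = fun _ => 1 := by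
    ext k
    fin_cases k <;> simp [ket]
  simp [stopper, intKet, factors, h]

theorem psi_eq_intKet (l : Fin 6) (i j : Fin 2) : psi l i j = intKet (factors (some (l, i, j))) := by
  have h0 : ket 0 = fun k => ((![1, 0, 0] : Fin 3 → ℤ) k : ℂ) := by
    ext k
    fin_cases k <;> simp [ket]
  have h2 : ket 2 = fun k => ((![0, 0, 1] : Fin 3 → ℤ) k : ℂ) := by
    ext k
    fin_cases k <;> simp [ket]
  have hη : eta i = fun k => ((![1, (-1) ^ (i : ℕ), 0] : Fin 3 → ℤ) k : ℂ) := by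
    ext k
    fin_cases k <;> simp [eta, ket]
  have hξ : xi j = fun k => ((![0, 1, (-1) ^ (j : ℕ)] : Fin 3 → ℤ) k : ℂ) := by
    ext k
    fin_cases k <;> simp [xi, ket]
  fin_cases l <;> simp only [psi, hη, hξ, h0, h2] <;> rfl

theorem mem_upb3 {ψ : Fin 3 × Fin 3 × Fin 3 → ℂ} :
    ψ ∈ upb3 ↔ ∃ s ∈ labels, intKet (factors s) = ψ := by
  simp [upb3, labels, Option.exists, ← stopper_eq_intKet, ← psi_eq_intKet, eq_comm]

/-- A vector shared by two labels would be orthogonal to itself, yet its self-product is nonzero. -/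
theorem intKet_factors_injOn : Set.InjOn (fun s => intKet (factors s)) labels := by
  intro s hs t ht h
  by_contra hne
  have h1 := braket_intKet (factors s) (factors t)
  rw [factors_orthogonal s hs t ht hne, ← show intKet _ = intKet _ from h, braket_intKet] at h1
  exact factors_self_ne_zero s hs (by exact_mod_cast h1)

theorem card_upb3 : upb3.card = 19 := by
  classical
  rw [← card_labels, ← Finset.card_image_of_injOn intKet_factors_injOn]
  congr 1
  ext ψ
  rw [mem_upb3, Finset.mem_image]

theorem upb3_ne_zero : ∀ ψ ∈ upb3, ψ ≠ 0 := by
  rintro _ hψ rfl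
  obtain ⟨s, hs, h⟩ := mem_upb3.1 hψ
  have h1 := braket_intKet (factors s) (factors s)
  rw [h, braket, dotProduct_zero] at h1
  exact factors_self_ne_zero s hs (by exact_mod_cast h1.symm)

theorem upb3_orthogonal : ∀ ψ ∈ upb3, ∀ φ ∈ upb3, ψ ≠ φ → braket ψ φ = 0 := by
  intro ψ hψ φ hφ hne
  obtain ⟨s, hs, rfl⟩ := mem_upb3.1 hψ
  obtain ⟨t, ht, rfl⟩ := mem_upb3.1 hφ
  rw [braket_intKet, factors_orthogonal s hs t ht fun h => hne (by rw [h]), Int.cast_zero]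

/-! ## The orthogonal complement -/

/-- `v` is constant on the supports of the `|ψ(i,j)⟩_l`, for each of the six `l`, and its
coefficients sum to zero. -/
structure TileConstant (v : Fin 3 × Fin 3 × Fin 3 → ℂ) : Prop where
  tile1 : v (0, 0, 1) = v (0, 0, 2) ∧ v (0, 0, 1) = v (0, 1, 1) ∧ v (0, 0, 1) = v (0, 1, 2)
  tile2 : v (0, 2, 1) = v (0, 2, 2) ∧ v (0, 2, 1) = v (1, 2, 1) ∧ v (0, 2, 1) = v (1, 2, 2)
  tile3 : v (2, 1, 0) = v (2, 2, 0) ∧ v (2, 1, 0) = v (2, 1, 1) ∧ v (2, 1, 0) = v (2, 2, 1)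
  tile4 : v (0, 1, 0) = v (0, 2, 0) ∧ v (0, 1, 0) = v (1, 1, 0) ∧ v (0, 1, 0) = v (1, 2, 0)
  tile5 : v (1, 0, 0) = v (2, 0, 0) ∧ v (1, 0, 0) = v (1, 0, 1) ∧ v (1, 0, 0) = v (2, 0, 1)
  tile6 : v (1, 0, 2) = v (2, 0, 2) ∧ v (1, 0, 2) = v (1, 1, 2) ∧ v (1, 0, 2) = v (2, 1, 2)
  sum : v (0, 0, 0) + v (1, 1, 1) + v (2, 2, 2) + 4 * v (0, 0, 1) + 4 * v (0, 2, 1) +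
    4 * v (2, 1, 0) + 4 * v (0, 1, 0) + 4 * v (1, 0, 0) + 4 * v (1, 0, 2) = 0

/-- The sign patterns are the nonconstant rows of a 4 × 4 Hadamard matrix, whose common kernel is
the constants. -/
theorem eq_of_signed_sums {a b c d : ℂ} (h1 : a - b + c - d = 0) (h2 : a + b - c - d = 0)
    (h3 : a - b - c + d = 0) : a = b ∧ a = c ∧ a = d :=
  ⟨by linear_combination (h1 + h3) / 2, by linear_combination (h2 + h3) / 2,
    by linear_combination (h1 + h2) / 2⟩

theorem tileConstant_of_orthogonal {v : Fin 3 × Fin 3 × Fin 3 → ℂ}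
    (hv : ∀ ψ ∈ upb3, braket ψ v = 0) : TileConstant v := by
  have hψ (l : Fin 6) (i j : Fin 2) (h : (i, j) ≠ (0, 0)) :
      braket (intKet (factors (some (l, i, j)))) v = 0 :=
    hv _ (mem_upb3.2 ⟨_, by simpa [labels] using h, rfl⟩)
  have hS : braket (intKet (factors none)) v = 0 := hv _ (mem_upb3.2 ⟨_, by simp [labels], rfl⟩)
  have tile (l : Fin 6) := And.intro (hψ l 0 1 (by decide))
    (And.intro (hψ l 1 0 (by decide)) (hψ l 1 1 (by decide)))
  have h1 := tile 0
  have h2 := tile 1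
  have h3 := tile 2
  have h4 := tile 3
  have h5 := tile 4
  have h6 := tile 5
  simp [braket, dotProduct, Fintype.sum_prod_type, Fin.sum_univ_three, intKet, prodKet,
    factors] at h1 h2 h3 h4 h5 h6 hS
  have t1 : v (0, 0, 1) = v (0, 0, 2) ∧ v (0, 0, 1) = v (0, 1, 1) ∧ v (0, 0, 1) = v (0, 1, 2) :=
    eq_of_signed_sums (by linear_combination h1.1) (by linear_combination h1.2.1)
      (by linear_combination h1.2.2)
  have t2 : v (0, 2, 1) = v (0, 2, 2) ∧ v (0, 2, 1) = v (1, 2, 1) ∧ v (0, 2, 1) = v (1, 2, 2) :=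
    eq_of_signed_sums (by linear_combination h2.1) (by linear_combination h2.2.1)
      (by linear_combination h2.2.2)
  have t3 : v (2, 1, 0) = v (2, 2, 0) ∧ v (2, 1, 0) = v (2, 1, 1) ∧ v (2, 1, 0) = v (2, 2, 1) :=
    eq_of_signed_sums (by linear_combination h3.1) (by linear_combination h3.2.1)
      (by linear_combination h3.2.2)
  have t4 : v (0, 1, 0) = v (0, 2, 0) ∧ v (0, 1, 0) = v (1, 1, 0) ∧ v (0, 1, 0) = v (1, 2, 0) :=
    eq_of_signed_sums (by linear_combination h4.1) (by linear_combination h4.2.1)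
      (by linear_combination h4.2.2)
  have t5 : v (1, 0, 0) = v (2, 0, 0) ∧ v (1, 0, 0) = v (1, 0, 1) ∧ v (1, 0, 0) = v (2, 0, 1) :=
    eq_of_signed_sums (by linear_combination h5.1) (by linear_combination h5.2.1)
      (by linear_combination h5.2.2)
  have t6 : v (1, 0, 2) = v (2, 0, 2) ∧ v (1, 0, 2) = v (1, 1, 2) ∧ v (1, 0, 2) = v (2, 1, 2) :=
    eq_of_signed_sums (by linear_combination h6.1) (by linear_combination h6.2.1)
      (by linear_combination h6.2.2)
  refine ⟨t1, t2, t3, t4, t5, t6, ?_⟩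
  linear_combination hS + t1.1 + t1.2.1 + t1.2.2 + t2.1 + t2.2.1 + t2.2.2 + t3.1 + t3.2.1 +
    t3.2.2 + t4.1 + t4.2.1 + t4.2.2 + t5.1 + t5.2.1 + t5.2.2 + t6.1 + t6.2.1 + t6.2.2

/-- The shift permutes the six tiles and the three diagonal cells. -/
theorem TileConstant.cyclic {v : Fin 3 × Fin 3 × Fin 3 → ℂ} (hv : TileConstant v) :
    TileConstant fun x => v (x.2.2, x.1, x.2.1) := by
  obtain ⟨⟨a1, a2, a3⟩, ⟨b1, b2, b3⟩, ⟨c1, c2, c3⟩, ⟨d1, d2, d3⟩, ⟨e1, e2, e3⟩,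
    ⟨f1, f2, f3⟩, hs⟩ := hv
  constructor <;> grind

/-- A vector that is constant on tiles, sums to zero and is a product across `A|BC` has no
component along `|111⟩`. -/
theorem TileConstant.mid_eq_zero {x : Fin 3 → ℂ} {y : Fin 3 × Fin 3 → ℂ}
    (h : TileConstant fun p => x p.1 * y p.2) : x 1 * y (1, 1) = 0 := by
  obtain ⟨⟨a1, a2, a3⟩, ⟨b1, b2, b3⟩, ⟨c1, c2, c3⟩, ⟨d1, d2, d3⟩, ⟨e1, e2, e3⟩,
    ⟨f1, f2, f3⟩, hs⟩ := h
  by_contra hne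
  obtain ⟨h1, h11⟩ := mul_ne_zero_iff.1 hne
  -- If a tile holds two cells differing only in A, then `y` vanishes there as soon as the two
  -- values of `x` differ.
  have cancel {a b c : ℂ} (hab : a ≠ b) (h : a * c = b * c) : c = 0 :=
    (mul_eq_mul_right_iff.1 h).resolve_left hab
  by_cases h01 : x 0 = x 1
  · by_cases h12 : x 1 = x 2
    -- With `x` constant and nonzero, the tiles link all entries of `y`, so the vector is constant
    -- and its sum is 27 times a nonzero number.
    · grind
    · have y00 : y (0, 0) = 0 := cancel h12 e1
      have y01 : y (0, 1) = 0 := cancel h12 (by grind)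
      have x0 : x 0 = 0 := by grind
      grind
  · have y10 : y (1, 0) = 0 := cancel h01 d2
    have y20 : y (2, 0) = 0 := cancel h01 (by grind)
    have y21 : y (2, 1) = 0 := cancel h01 b2
    have y22 : y (2, 2) = 0 := cancel h01 (by grind)
    have x2 : x 2 = 0 := by grind
    have y00 : y (0, 0) = 0 := by grind
    have y01 : y (0, 1) = 0 := by grind
    have x0 : x 0 = 0 := by grind
    -- Now every term of the sum other than `x 1 * y (1, 1)` is zero.
    grind

/-- Tiles 2, 4, 5 and 6 meet the slice where A has index 1, so they vanish. Only tiles 1 and 3 and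
the corners 000 and 222 remain. If tile 1 or tile 3 were nonzero, the other one and both corners
would vanish, against the zero sum. -/
theorem TileConstant.prodKet_eq_zero_of_left {a b c : Fin 3 → ℂ}
    (h : TileConstant (prodKet a b c)) (hz : a 1 = 0) : prodKet a b c = 0 := by
  obtain ⟨⟨a1, a2, a3⟩, ⟨b1, b2, b3⟩, ⟨c1, c2, c3⟩, ⟨d1, d2, d3⟩, ⟨e1, e2, e3⟩,
    ⟨f1, f2, f3⟩, hs⟩ := h
  simp only [prodKet, hz, zero_mul, mul_zero, add_zero]
    at a1 a2 a3 b1 b2 b3 c1 c2 c3 d1 d2 d3 e1 e2 e3 f1 f2 f3 hs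
  have t3 : a 2 * b 1 * c 0 = 0 := by
    by_contra hne
    obtain ⟨⟨ha2, hb1⟩, hc0⟩ : (a 2 ≠ 0 ∧ b 1 ≠ 0) ∧ c 0 ≠ 0 := by simpa using hne
    have hc1 : c 1 ≠ 0 := fun h => hne (by rw [c2, h, mul_zero])
    have hc2 : c 2 = 0 := by
      have : a 2 * b 1 * c 2 = 0 := by rw [← f3]
      simpa [ha2, hb1] using this
    have ha0 : a 0 = 0 := by
      have : a 0 * b 1 * c 1 = 0 := by rw [← a2, a1, hc2, mul_zero]
      simpa [hb1, hc1] using this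
    simp [ha0, hc2] at hs
    grind
  have t1 : a 0 * b 0 * c 1 = 0 := by
    by_contra hne
    obtain ⟨⟨ha0, hb0⟩, hc1⟩ : (a 0 ≠ 0 ∧ b 0 ≠ 0) ∧ c 1 ≠ 0 := by simpa using hne
    have hb1 : b 1 ≠ 0 := fun h => hne (by rw [a2, h, mul_zero, zero_mul])
    have hc0 : c 0 = 0 := by
      have : a 0 * b 1 * c 0 = 0 := d2
      simpa [ha0, hb1] using this
    have ha2 : a 2 = 0 := by
      have : a 2 * b 1 * c 1 = 0 := by rw [← c2, t3]
      simpa [hb1, hc1] using this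
    simp [ha2, hc0] at hs
    grind
  -- The two corners sum to zero; were they nonzero, so would be mixed products such as `a 2 * b 0 *
  -- c 0`, which lies in a vanishing tile.
  have d0 : a 0 * b 0 * c 0 = 0 := by grind
  have d2 : a 2 * b 2 * c 2 = 0 := by grind
  have three : ∀ k : Fin 3, k = 0 ∨ k = 1 ∨ k = 2 := by decide
  ext ⟨p, q, r⟩
  change a p * b q * c r = 0
  rcases three p with rfl | rfl | rfl
  · rcases three q with rfl | rfl | rfl <;> rcases three r with rfl | rfl | rfl <;> grind
  · rw [hz, zero_mul, zero_mul]
  · rcases three q with rfl | rfl | rfl <;> rcases three r with rfl | rfl | rfl <;> grind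

theorem TileConstant.prodKet_eq_zero {a b c : Fin 3 → ℂ}
    (h : TileConstant (prodKet a b c)) : prodKet a b c = 0 := by
  have h' : TileConstant (prodKet b c a) := by
    convert h.cyclic using 2
    simp only [prodKet]
    ring
  have h'' : TileConstant (prodKet c a b) := by
    convert h'.cyclic using 2
    simp only [prodKet]
    ring
  have hmid : a 1 * (b 1 * c 1) = 0 :=
    TileConstant.mid_eq_zero (x := a) (y := fun p => b p.1 * c p.2) <| by
      convert h using 2
      simp only [prodKet]
      ring
  rcases mul_eq_zero.1 hmid with ha | hbc
  · exact h.prodKet_eq_zero_of_left ha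
  rcases mul_eq_zero.1 hbc with hb | hc
  · have hz := h'.prodKet_eq_zero_of_left hb
    ext ⟨p, q, r⟩
    have := congrFun hz (q, r, p)
    simp only [prodKet, Pi.zero_apply] at this ⊢
    linear_combination this
  · have hz := h''.prodKet_eq_zero_of_left hc
    ext ⟨p, q, r⟩
    have := congrFun hz (r, p, q)
    simp only [prodKet, Pi.zero_apply] at this ⊢
    linear_combination this

theorem exists_ne_zero_orthogonal_upb3 :
    ∃ v : Fin 3 × Fin 3 × Fin 3 → ℂ, v ≠ 0 ∧ ∀ ψ ∈ upb3, braket ψ v = 0 := by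
  have hf : ∀ s ∈ labels, ∏ p, factors s p 0 = ∏ p, factors s p 1 := by decide +kernel
  -- Diagonal cells lie in no tile, and `|S⟩` has equal coefficients on them.
  refine ⟨Pi.single (0, 0, 0) 1 - Pi.single (1, 1, 1) 1, fun h => ?_, fun ψ hψ => ?_⟩
  · simpa using congrFun h (0, 0, 0)
  · obtain ⟨s, hs, rfl⟩ := mem_upb3.1 hψ
    have h := congrArg (Int.cast : ℤ → ℂ) (hf s hs)
    simp only [Fin.prod_univ_three, Int.cast_mul] at h
    simp [braket, intKet, prodKet, h]

theorem isUPB_upb3 : IsUPB upb3 where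
  product ψ hψ := by
    obtain ⟨s, -, rfl⟩ := mem_upb3.1 hψ
    exact ⟨_, _, _, rfl⟩
  ne_zero := upb3_ne_zero
  orthogonal := upb3_orthogonal
  incomplete := exists_ne_zero_orthogonal_upb3
  unextendible _ _ _ h := (tileConstant_of_orthogonal h).prodKet_eq_zero

/-! ## The state -/

theorem eight_smul_rho3 : (8 : ℂ) • rho3 = 1 - ∑ ψ ∈ upb3, proj (normalized ψ) := by
  rw [rho3, smul_smul]
  norm_num

theorem isStarProjection_eight_smul_rho3 : IsStarProjection ((8 : ℂ) • rho3) := by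
  rw [eight_smul_rho3]
  exact (isStarProjection_sum_proj_normalized upb3_ne_zero upb3_orthogonal).one_sub

theorem trace_eight_smul_rho3 : ((8 : ℂ) • rho3).trace = 8 := by
  rw [eight_smul_rho3, Matrix.trace_sub, trace_sum_proj_normalized upb3_ne_zero, card_upb3,
    Matrix.trace_one]
  simp
  norm_num

theorem posSemidef_rho3 : rho3.PosSemidef := by
  have h : rho3 = (1 / 8 : ℂ) • ((8 : ℂ) • rho3) := by
    rw [smul_smul]
    norm_num
  rw [h]
  refine (posSemidef_of_isStarProjection isStarProjection_eight_smul_rho3).smul ?_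
  norm_num [Complex.le_def]

theorem rho3_mem_densityOps : rho3 ∈ densityOps (Fin 3 × Fin 3 × Fin 3) := by
  refine ⟨posSemidef_rho3, ?_⟩
  have h := trace_eight_smul_rho3
  rw [Matrix.trace_smul, smul_eq_mul] at h
  linear_combination h / 8

theorem rank_rho3 : rho3.rank = 8 := by
  have h := trace_eq_rank_of_isIdempotentElem isStarProjection_eight_smul_rho3.isIdempotentElem
  rw [trace_eight_smul_rho3, Matrix.rank_smul_of_mem_nonZeroDivisors _ (by simp)] at h
  exact_mod_cast h.symm

theorem eight_smul_rho3_mulVec_eq_self_iff (v : Fin 3 × Fin 3 × Fin 3 → ℂ) :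
    ((8 : ℂ) • rho3) *ᵥ v = v ↔ ∀ ψ ∈ upb3, braket ψ v = 0 := by
  rw [eight_smul_rho3, Matrix.sub_mulVec, Matrix.one_mulVec, sub_eq_self]
  exact sum_proj_normalized_mulVec_eq_zero_iff upb3_ne_zero upb3_orthogonal v

theorem rho3_mulVec_eq_zero : ∀ ψ ∈ upb3, rho3 *ᵥ ψ = 0 := by
  intro ψ hψ
  have h : ((8 : ℂ) • rho3) *ᵥ ψ = 0 := by
    rw [eight_smul_rho3, Matrix.sub_mulVec, Matrix.one_mulVec, sub_eq_zero,
      sum_proj_normalized_mulVec_self upb3_ne_zero upb3_orthogonal hψ]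
  rw [Matrix.smul_mulVec] at h
  exact (smul_eq_zero.1 h).resolve_left (by norm_num)

theorem rho3_apply (p q : Fin 3 × Fin 3 × Fin 3) : rho3 p q =
    1 / 8 * ((1 : Matrix _ _ ℂ) p q - ∑ ψ ∈ upb3, (braket ψ ψ)⁻¹ * (ψ p * star (ψ q))) := by
  simp only [rho3, Matrix.smul_apply, Matrix.sub_apply, Matrix.sum_apply, proj_normalized,
    smul_eq_mul]
  rfl

/-- Two entries of `ρ` agree if they agree for the identity and for all real product vectors. -/
theorem rho3_apply_congr {p q p' q' : Fin 3 × Fin 3 × Fin 3} (h1 : p = q ↔ p' = q')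
    (h : ∀ f, intKet f p * intKet f q = intKet f p' * intKet f q') :
    rho3 p q = rho3 p' q' := by
  rw [rho3_apply, rho3_apply]
  congr 2
  · simp only [Matrix.one_apply, h1]
  · refine Finset.sum_congr rfl fun ψ hψ => ?_
    obtain ⟨s, -, rfl⟩ := mem_upb3.1 hψ
    -- Reality removes the conjugation, so exchanging one party's row and column indices only
    -- permutes scalar factors.
    have hr (x) : star (intKet (factors s) x) = intKet (factors s) x := by simp [intKet, prodKet]
    rw [hr, hr, h]

theorem ptA_rho3 : ptA rho3 = rho3 := by
  ext p q
  refine rho3_apply_congr (by grind) fun f => ?_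
  simp only [intKet, prodKet]
  ring

theorem ptB_rho3 : ptB rho3 = rho3 := by
  ext p q
  refine rho3_apply_congr (by grind) fun f => ?_
  simp only [intKet, prodKet]
  ring

theorem ptC_rho3 : ptC rho3 = rho3 := by
  ext p q
  refine rho3_apply_congr (by grind) fun f => ?_
  simp only [intKet, prodKet]
  ring

theorem rho3_mem_pptInt : rho3 ∈ pptInt (Fin 3) (Fin 3) (Fin 3) := by
  simp [pptInt, pptA, pptB, pptC, ptA_rho3, ptB_rho3, ptC_rho3, rho3_mem_densityOps,
    posSemidef_rho3]

/-! ### Inseparability -/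

/-- Only `|S⟩` contributes to the component of `ρ` along `|111⟩`. -/
theorem rho3_mid_ne_zero : rho3 (1, 1, 1) (1, 1, 1) ≠ 0 := by
  have hf : ∀ s ∈ labels, s ≠ none → ∏ p, factors s p 1 = 0 := by decide +kernel
  have hS : stopper ∈ upb3 := Finset.mem_insert_self _ _
  rw [rho3_apply, Finset.sum_eq_single_of_mem stopper hS, stopper_eq_intKet, braket_intKet]
  -- The entry is `(1 - 1/27) / 8`.
  · norm_num [factors, intKet, prodKet, Fin.prod_univ_three]
  · intro ψ hψ hne
    obtain ⟨s, hs, rfl⟩ := mem_upb3.1 hψ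
    have h := congrArg (Int.cast : ℤ → ℂ)
      (hf s hs fun h => hne (by rw [h, stopper_eq_intKet]))
    simp only [Fin.prod_univ_three, Int.cast_mul, Int.cast_zero] at h
    simp [intKet, prodKet, h]

theorem rho3_notMem_convexHull {S : Set (Matrix (Fin 3 × Fin 3 × Fin 3) (Fin 3 × Fin 3 × Fin 3) ℂ)}
    (hS : ∀ σ ∈ S, ∃ χ, σ = proj χ ∧ (TileConstant χ → χ (1, 1, 1) = 0)) :
    rho3 ∉ convexHull ℝ S := fun h =>
  rho3_mid_ne_zero <| diag_eq_zero_of_mem_convexHull h rho3_mulVec_eq_zero _ fun σ hσ =>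
    let ⟨χ, h, hχ⟩ := hS σ hσ
    ⟨χ, h, fun ho => hχ (tileConstant_of_orthogonal ho)⟩

theorem rho3_notMem_bisepA : rho3 ∉ bisepA (Fin 3) (Fin 3) (Fin 3) := by
  refine rho3_notMem_convexHull ?_
  rintro _ ⟨x, y, -, -, rfl⟩
  exact ⟨_, rfl, fun h => h.mid_eq_zero⟩

theorem rho3_notMem_bisepB : rho3 ∉ bisepB (Fin 3) (Fin 3) (Fin 3) := by
  refine rho3_notMem_convexHull ?_
  rintro _ ⟨x, y, -, -, rfl⟩
  -- One shift brings B to the first position; for C two are needed.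
  exact ⟨_, rfl, fun h => h.cyclic.mid_eq_zero⟩

theorem rho3_notMem_bisepC : rho3 ∉ bisepC (Fin 3) (Fin 3) (Fin 3) := by
  refine rho3_notMem_convexHull ?_
  rintro _ ⟨x, y, -, -, rfl⟩
  exact ⟨_, rfl, fun h => h.cyclic.cyclic.mid_eq_zero⟩

end Tripartite

theorem proposition1 :
    -- the underlying set is a 19-element unextendible product basis
    (upb3.card = 19 ∧ IsUPB upb3) ∧
    -- `ρ` is a density operator of rank 8, and `8 ρ` is the orthogonal projector onto the
    -- orthogonal complement of this basis
    (rho3 ∈ densityOps (Fin 3 × Fin 3 × Fin 3) ∧ rho3.rank = 8 ∧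
      IsStarProjection ((8 : ℂ) • rho3) ∧
      ∀ v : Fin 3 × Fin 3 × Fin 3 → ℂ,
        ((8 : ℂ) • rho3) *ᵥ v = v ↔ ∀ ψ ∈ upb3, braket ψ v = 0) ∧
    -- `ρ` is invariant under each partial transposition
    (ptA rho3 = rho3 ∧ ptB rho3 = rho3 ∧ ptC rho3 = rho3) ∧
    -- `ρ` is PPT across all three cuts
    rho3 ∈ pptInt (Fin 3) (Fin 3) (Fin 3) ∧
    -- `ρ` is not separable across any of the three cuts
    (rho3 ∉ bisepA (Fin 3) (Fin 3) (Fin 3) ∧ rho3 ∉ bisepB (Fin 3) (Fin 3) (Fin 3) ∧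
      rho3 ∉ bisepC (Fin 3) (Fin 3) (Fin 3)) ∧
    rho3 ∉ bisepInt (Fin 3) (Fin 3) (Fin 3) := by
  exact ⟨⟨card_upb3, isUPB_upb3⟩,
    ⟨rho3_mem_densityOps, rank_rho3, isStarProjection_eight_smul_rho3,
      eight_smul_rho3_mulVec_eq_self_iff⟩,
    ⟨ptA_rho3, ptB_rho3, ptC_rho3⟩, rho3_mem_pptInt,
    ⟨rho3_notMem_bisepA, rho3_notMem_bisepB, rho3_notMem_bisepC⟩,
    fun h => rho3_notMem_bisepA h.1.1⟩
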